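/- All graphs are finite. A mixed graph has disjoint sets of input nodes $\mathcal I$ and output nodes $\mathcal V$ and edges of the types $\to,\leftarrow,\leftrightarrow,-$ (two nodes may be joined by edges of several types); $*$ stands for an arbitrary edge mark. A walk is a sequence of nodes $v_0,\dots,v_n$ ($n\ge 0$) together with a chosen edge between $v_i$ and $v_{i+1}\neq v_i$ for each $i<n$; a path is a walk without repeated nodes. A non-endnode $v_i$ is a collider on a walk if both edges of the walk at it have an arrowhead at $v_i$, and a non-collider otherwise. $\mathsf{Anc}(X)$ is the set of nodes $a$ such that $a\in X$ or there is a directed path $a\to\cdots\to x$ with $x\in X$. For a set $S$ of nodes, a path from $a$ to $b$ is $S$-inducing if every non-endnode on it is a collider and lies in $\mathsf{Anc}(\{a,b\}\cup S)$. An iMAG $\mathfrak M=(\mathcal I,\mathcal V,\mathcal E)$ is a mixed graph such that (1) there is at most one edge between two distinct nodes and no edge between a node and itself; (2) there are no arrowheads at input nodes and no edges between input nodes; (3) there are no directed cycles $a\to\cdots\to a$, no almost directed cycles $a\to\cdots\to b\leftrightarrow a$, and no triples $a\,{*\!\!\to}\, b - c$; (4) there is no $\emptyset$-inducing path between distinct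 non-adjacent nodes. An isADMG $\mathfrak A=(\mathcal I,\mathcal O,\mathcal S_{\mathfrak A},\mathcal E)$ is a mixed graph with input nodes $\mathcal I$ and output nodes $\mathcal O\,\dot\cup\,\mathcal S_{\mathfrak A}$ (observed nodes and latent selection nodes), with edges of the types $\to,\leftarrow,\leftrightarrow$ only, without edges between a node and itself, arrowheads at input nodes, or directed cycles. It is represented by the iMAG $\mathfrak M=(\mathcal I,\mathcal V,\mathcal E)$ if it has the same input nodes, $\mathcal O=\mathcal V$, and: distinct $a,b\in\mathcal I\cup\mathcal V$ are adjacent in $\mathfrak M$ iff $\{a,b\}\not\subseteq\mathcal I$ and there is an $\mathcal S_{\mathfrak A}$-inducing path from $a$ to $b$ in $\mathfrak A$; if an edge of $\mathfrak M$ between $a$ and $b$ has an arrowhead at $a$, then $a\notin\mathsf{Anc}_{\mathfrak A}(\{b\}\cup\mathcal S_{\mathfrak A})$; if it has a tail at $a$, then $a\in\mathsf{Anc}_{\mathfrak A}(\{b\}\cup\mathcal S_{\mathfrak A})$. In either kind of graph $\mathfrak G$, a walk is $id$-open given a set $C$ of nodes if its endnodes are not in $C$, each non-collider on it is not in $C$,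 and each collider on it is in $\mathsf{Anc}_{\mathfrak G}(C)$. $A$ is $id$-separated from $B$ given $C$ in $\mathfrak G$, written $A\perp^{\mathsf{id}}_{\mathfrak G}B\mid C$, if no walk from a node in $A$ to a node in $B\cup\mathcal I$ is $id$-open given $C$. **Proposition.** Let $\mathfrak M=(\mathcal I,\mathcal V,\mathcal E)$ be an iMAG and let $A,B,C\subseteq\mathcal I\cup\mathcal V$ be arbitrary (not necessarily disjoint). Then $$A\perp^{\mathsf{id}}_{\mathfrak M}B\mid C\quad\Longleftrightarrow\quad A\perp^{\mathsf{id}}_{\mathfrak A}B\mid C\cup\mathcal S_{\mathfrak A}\ \text{ for every isADMG } \mathfrak A \text{ represented by } \mathfrak M .$$ -/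

import Mathlib

universe u

/-- The mark of an edge at one of its two ends. -/
inductive EndMark
  | tail
  | arrow

/-- A mixed graph with input nodes `I` and output nodes `V`; its node set is the disjoint union
`I ⊕ V`. The proposition `edge a b m m'` says that there is an edge between `a` and `b` with mark
`m` at `a` and mark `m'` at `b`. So `edge a b .tail .arrow` is `a → b`, `edge a b .arrow .arrow` is
`a ↔ b` and `edge a b .tail .tail` is `a — b`. Two nodes may be joined by several edges of
different types. -/
structure MixedGraph (I V : Type*) where
  edge : I ⊕ V → I ⊕ V → EndMark → EndMark → Prop
  edge_symm : ∀ {a b m m'}, edge a b m m' → edge b a m' m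

namespace MixedGraph

variable {I V : Type*}

/-- Two nodes are adjacent if there is an edge between them. -/
def Adj (G : MixedGraph I V) (a b : I ⊕ V) : Prop :=
  ∃ m m', G.edge a b m m'

/-- `a` is a parent of `b`: the directed edge `a → b` is in the graph. -/
def Parent (G : MixedGraph I V) (a b : I ⊕ V) : Prop :=
  G.edge a b .tail .arrow

/-- The set of ancestors of a set of nodes (every node is an ancestor of itself). -/
def Anc (G : MixedGraph I V) (X : Set (I ⊕ V)) : Set (I ⊕ V) :=
  {a | ∃ b ∈ X, Relation.ReflTransGen G.Parent a b}

/-- The set of input nodes. -/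
def inputs (I V : Type*) : Set (I ⊕ V) :=
  Set.range Sum.inl

/-- A walk `v₀ ∗—∗ v₁ ∗—∗ ⋯ ∗—∗ vₙ` with `n = length ≥ 0`. The edge number `i`, between `node i` and
`node (i + 1)`, has mark `markL i` at `node i` and mark `markR i` at `node (i + 1)`. Only the nodes
`0, …, n` and the edges `0, …, n - 1` belong to the walk. -/
structure Walk (G : MixedGraph I V) where
  length : ℕ
  node : ℕ → I ⊕ V
  markL : ℕ → EndMark
  markR : ℕ → EndMark
  node_ne : ∀ i < length, node i ≠ node (i + 1)
  edge_mem : ∀ i < length, G.edge (node i) (node (i + 1)) (markL i) (markR i)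

namespace Walk

variable {G : MixedGraph I V}

/-- The first node of a walk. -/
def first (π : G.Walk) : I ⊕ V := π.node 0

/-- The last node of a walk. -/
def last (π : G.Walk) : I ⊕ V := π.node π.length

/-- A path is a walk without repeated nodes. -/
def IsPath (π : G.Walk) : Prop :=
  ∀ i ≤ π.length, ∀ j ≤ π.length, π.node i = π.node j → i = j

/-- The non-endnode `node (i + 1)` is a collider on the walk: both edges of the walk that meet there
have an arrowhead at it. -/
def ColliderAt (π : G.Walk) (i : ℕ) : Prop :=
  π.markR i = .arrow ∧ π.markL (i + 1) = .arrow

/-- The walk is inducing relative to `L` given `S`. -/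
def IsInducing (π : G.Walk) (L S : Set (I ⊕ V)) : Prop :=
  (∀ i, i + 1 < π.length → π.node (i + 1) ∈ L ∨ π.ColliderAt i) ∧
  (∀ i, i + 1 < π.length → π.ColliderAt i → π.node (i + 1) ∈ G.Anc ({π.first, π.last} ∪ S))

/-- The walk is `id`-open given `C`: its endnodes are not in `C`, its non-colliders are not in `C`,
and its colliders are ancestors of `C`. -/
def IdOpen (π : G.Walk) (C : Set (I ⊕ V)) : Prop :=
  (π.first ∉ C ∧ π.last ∉ C) ∧
  ∀ i, i + 1 < π.length →
    (π.markR i = .tail ∧ π.node (i + 1) ∉ C) ∨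
    (π.markL (i + 1) = .tail ∧ π.node (i + 1) ∉ C) ∨
    (π.ColliderAt i ∧ π.node (i + 1) ∈ G.Anc C)

end Walk

/-- There is an inducing path from `a` to `b` relative to `L` given `S`. -/
def HasInducingPath (G : MixedGraph I V) (L S : Set (I ⊕ V)) (a b : I ⊕ V) : Prop :=
  ∃ π : G.Walk, π.IsPath ∧ π.first = a ∧ π.last = b ∧ π.IsInducing L S

/-- `A` is `id`-separated from `B` given `C`: every walk from a node in `A` to a node in `B` or to
an input node is blocked, i.e. not open, given `C`. -/
def IdSep (G : MixedGraph I V) (A B C : Set (I ⊕ V)) : Prop :=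
  ∀ π : G.Walk, π.first ∈ A → π.last ∈ B ∪ inputs I V → ¬ π.IdOpen C

/-- An acyclic directed mixed graph with input nodes (iADMG). -/
structure IsIADMG (G : MixedGraph I V) : Prop where
  /-- All edges are of the types `→`, `←`, `↔`. -/
  not_undirected : ∀ a b, ¬ G.edge a b .tail .tail
  /-- There are no edges between a node and itself. -/
  not_loop : ∀ a m m', ¬ G.edge a a m m'
  /-- There are no arrowheads towards input nodes. -/
  not_into_input : ∀ a (i : I) m, ¬ G.edge a (Sum.inl i) m .arrow
  /-- There are no directed cycles. -/
  acyclic : ∀ a, ¬ Relation.TransGen G.Parent a a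

/-- A maximal ancestral graph with input nodes (iMAG). -/
structure IsIMAG (G : MixedGraph I V) : Prop where
  /-- There is at most one edge between any two nodes. -/
  edge_unique : ∀ {a b m m' k k'}, G.edge a b m m' → G.edge a b k k' → m = k ∧ m' = k'
  /-- There are no edges between a node and itself. -/
  not_loop : ∀ a m m', ¬ G.edge a a m m'
  /-- There are no arrowheads towards input nodes. -/
  not_into_input : ∀ a (i : I) m, ¬ G.edge a (Sum.inl i) m .arrow
  /-- There are no edges between input nodes. -/
  not_adj_inputs : ∀ i j : I, ¬ G.Adj (Sum.inl i) (Sum.inl j)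
  /-- There are no directed cycles. -/
  acyclic : ∀ a, ¬ Relation.TransGen G.Parent a a
  /-- There are no almost directed cycles `a → ⋯ → b ↔ a`. -/
  not_almost_cycle : ∀ a b, Relation.TransGen G.Parent a b → ¬ G.edge b a .arrow .arrow
  /-- There are no triples `a ∗→ b — c`. -/
  not_into_undirected : ∀ a b c m, G.edge a b m .arrow → ¬ G.edge b c .tail .tail
  /-- There is no inducing path between distinct non-adjacent nodes. -/
  maximal : ∀ a b, a ≠ b → ¬ G.Adj a b → ¬ G.HasInducingPath ∅ ∅ a b

end MixedGraph

/-- An isADMG with input nodes `I`, observed output nodes `O` and latent selection nodes `S`: an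
acyclic directed mixed graph with input nodes `I` and output nodes `O ⊕ S`. -/
structure ISADMG (I O S : Type*) extends MixedGraph I (O ⊕ S) where
  isIADMG : toMixedGraph.IsIADMG

namespace ISADMG

variable {I O S : Type*}

/-- The input nodes and the observed output nodes, as nodes of the isADMG. -/
def obs (S : Type*) {I O : Type*} : I ⊕ O → I ⊕ (O ⊕ S) :=
  Sum.map id Sum.inl

/-- The set of latent selection nodes. -/
def selection (I O S : Type*) : Set (I ⊕ (O ⊕ S)) :=
  Set.range (Sum.inr ∘ Sum.inr)

end ISADMG

/-- The graph `M` represents the isADMG `𝔄`, which has the same input nodes as `M` and whose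
observed output nodes are the output nodes of `M`. -/
structure MixedGraph.Represents {I V S : Type*} (M : MixedGraph I V) (𝔄 : ISADMG I V S) :
    Prop where
  adj_iff : ∀ a b, a ≠ b → (M.Adj a b ↔
    ¬ ({a, b} ⊆ MixedGraph.inputs I V) ∧
      𝔄.HasInducingPath ∅ (ISADMG.selection I V S) (ISADMG.obs S a) (ISADMG.obs S b))
  arrow : ∀ a b m, M.edge a b .arrow m →
    ISADMG.obs S a ∉ 𝔄.Anc ({ISADMG.obs S b} ∪ ISADMG.selection I V S)
  tail : ∀ a b m, M.edge a b .tail m →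
    ISADMG.obs S a ∈ 𝔄.Anc ({ISADMG.obs S b} ∪ ISADMG.selection I V S)

/-!
Both separations fail exactly when an open walk exists, and the theorem translates open walks
between `M` and the isADMGs that it represents.

*From `M` to some isADMG.* Replace every undirected edge `a — b` of `M` by `a → s ← b` with a new
selection node `s` (`canonical`). Since a node with an undirected edge has no arrowhead in `M`, this
creates no inducing paths other than `a → s ← b` and those of `M`, so maximality of `M` shows that
`M` represents the result (`represents_canonical`). An open walk of `M` lifts edge by edge
(`OpenReach.canonical`).

*From a represented isADMG to `M`.* Let `S` be the set of selection nodes. An open walk of the isADMG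
is a chain of inducing steps: collider walks whose interior lies in the ancestors of `S` and of the
two ends. Single edges are such steps, and two steps that meet head to head at a node `c` merge into
one when `c` is an ancestor of `S` or of one of the outer ends (`InducingStep.trans`). In a shortest
chain no merging is possible. So each collider that is left is observed and is no ancestor of `S` or
of its neighbours in the chain, which forces both edges of `M` at it to have arrowheads there; being
an ancestor of the conditioning set in the isADMG, it is one in `M` as well
(`Represents.mem_anc_of_obs_mem_anc`). A non-collider of the chain has a tail on one side,
which makes it an ancestor of `S` or of its neighbour on this side (`InducingStep.transGen_left`),
so that it is a non-collider in `M`. Hence the chain is an open walk of `M`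
(`Represents.openReach_of_minimal`). Inducing steps between two input nodes have no counterpart in
`M`, but they do no harm: an open walk that meets an input node may be stopped there.
-/

namespace MixedGraph

variable {I V : Type*}

/-! ### Open walks as a reachability relation -/

/-- The condition that openness given `C` imposes on a node `x` of a walk that is entered through
an edge with mark `m` at `x` and left through an edge with mark `k` at `x`. -/
def Passes (G : MixedGraph I V) (C : Set (I ⊕ V)) (m k : EndMark) (x : I ⊕ V) : Prop :=
  (m = .tail ∧ x ∉ C) ∨ (k = .tail ∧ x ∉ C) ∨ ((m = .arrow ∧ k = .arrow) ∧ x ∈ G.Anc C)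

/-- `G.OpenReach A C x m` says that there is a walk from `A` to `x` that arrives with mark `m` at
`x` and satisfies all conditions of being open given `C` except for the one at `x`. The trivial walk
counts as arriving with a tail, so that leaving its node requires exactly that it is not in `C`. -/
inductive OpenReach (G : MixedGraph I V) (A C : Set (I ⊕ V)) : I ⊕ V → EndMark → Prop
  | start {a : I ⊕ V} : a ∈ A → OpenReach G A C a .tail
  | step {x y : I ⊕ V} {m k l : EndMark} : OpenReach G A C x m → x ≠ y → G.edge x y k l →
      G.Passes C m k x → OpenReach G A C y l

lemma OpenReach.exists_walk {G : MixedGraph I V} {A C : Set (I ⊕ V)} {x : I ⊕ V} {m : EndMark}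
    (h : G.OpenReach A C x m) :
    ∃ π : G.Walk, π.first ∈ A ∧ π.last = x ∧ (0 < π.length → π.first ∉ C) ∧
      (π.length = 0 → m = .tail) ∧ (∀ n, π.length = n + 1 → π.markR n = m) ∧
      ∀ i, i + 1 < π.length → G.Passes C (π.markR i) (π.markL (i + 1)) (π.node (i + 1)) := by
  induction h with
  | @start a ha =>
    exact ⟨⟨0, fun _ => a, fun _ => .tail, fun _ => .tail, by simp, by simp⟩, ha, rfl, by simp,
      by simp, by simp, by simp⟩
  | @step x y m k l _ hne he hp ih =>
    obtain ⟨π, hA, hx, hC, h0, hn, ho⟩ := ih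
    have hx : π.node π.length = x := hx
    refine ⟨⟨π.length + 1, fun t => if t ≤ π.length then π.node t else y,
      fun t => if t < π.length then π.markL t else k,
      fun t => if t < π.length then π.markR t else l, ?_, ?_⟩, ?_, ?_, ?_, ?_, ?_, ?_⟩
    · intro i hi
      rcases Nat.lt_succ_iff_lt_or_eq.1 hi with h | rfl
      · simpa [h.le, Nat.succ_le_of_lt h] using π.node_ne i h
      · simpa [hx] using hne
    · intro i hi
      rcases Nat.lt_succ_iff_lt_or_eq.1 hi with h | rfl
      · simpa [h, h.le, Nat.succ_le_of_lt h] using π.edge_mem i h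
      · simpa [hx] using he
    · simpa [Walk.first] using hA
    · simp [Walk.last]
    · intro _
      simp only [Walk.first, Nat.zero_le, if_true]
      rcases Nat.eq_zero_or_pos π.length with h | h
      · have hm := h0 h
        rw [h] at hx
        rw [hx]
        rcases hp with hp | hp | hp
        · exact hp.2
        · exact hp.2
        · simp [hm] at hp
      · exact hC h
    · simp
    · intro n hn'
      have : n = π.length := by simpa using hn'.symm
      simp [this]
    · intro i hi
      have hi : i < π.length := by simpa using hi
      rcases Nat.lt_or_ge (i + 1) π.length with h | h
      · simpa [hi, h, h.le, Nat.succ_le_of_lt hi] using ho i h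
      · have hl : π.length = i + 1 := by omega
        have hx' : π.node (i + 1) = x := hl ▸ hx
        simpa [hl, hx', hn i hl] using hp

lemma Walk.openReach {G : MixedGraph I V} {A C : Set (I ⊕ V)} (π : G.Walk) (hA : π.first ∈ A)
    (hC : π.IdOpen C) : ∀ i < π.length, G.OpenReach A C (π.node (i + 1)) (π.markR i)
  | 0, hi => .step (.start hA) (π.node_ne 0 hi) (π.edge_mem 0 hi) (.inl ⟨rfl, hC.1.1⟩)
  | i + 1, hi => .step (Walk.openReach π hA hC i (by omega)) (π.node_ne _ hi) (π.edge_mem _ hi)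
      (hC.2 i hi)

lemma not_idSep_iff {G : MixedGraph I V} {A B C : Set (I ⊕ V)} :
    ¬ G.IdSep A B C ↔ ∃ b ∈ B ∪ inputs I V, b ∉ C ∧ ∃ m, G.OpenReach A C b m := by
  constructor
  · intro h
    simp only [IdSep, not_forall, not_not] at h
    obtain ⟨π, hA, hB, hC⟩ := h
    refine ⟨π.last, hB, hC.1.2, ?_⟩
    rcases hn : π.length with _ | n
    · refine ⟨.tail, ?_⟩
      rw [Walk.last, hn]
      exact .start hA
    · refine ⟨π.markR n, ?_⟩
      rw [Walk.last, hn]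
      exact π.openReach hA hC n (by omega)
  · rintro ⟨b, hB, hb, m, h⟩ hsep
    obtain ⟨π, hA, hl, hC, -, -, ho⟩ := h.exists_walk
    refine hsep π hA (hl ▸ hB) ⟨⟨?_, hl ▸ hb⟩, ho⟩
    rcases Nat.eq_zero_or_pos π.length with h | h
    · have : π.first = π.last := by rw [Walk.first, Walk.last, h]
      rw [this, hl]
      exact hb
    · exact hC h

/-! ### Ancestors -/

lemma Anc.of_transGen {G : MixedGraph I V} {X : Set (I ⊕ V)} {a b : I ⊕ V} (hb : b ∈ X)
    (h : Relation.TransGen G.Parent a b) : a ∈ G.Anc X :=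
  ⟨b, hb, h.to_reflTransGen⟩

lemma Anc.mono {G : MixedGraph I V} {X Y : Set (I ⊕ V)} (h : X ⊆ Y) : G.Anc X ⊆ G.Anc Y :=
  fun _ ⟨b, hb, hab⟩ => ⟨b, h hb, hab⟩

lemma subset_anc (G : MixedGraph I V) (X : Set (I ⊕ V)) : X ⊆ G.Anc X :=
  fun a ha => ⟨a, ha, .refl⟩

lemma Anc.subset_of_subset {G : MixedGraph I V} {X Y : Set (I ⊕ V)} (h : X ⊆ G.Anc Y) :
    G.Anc X ⊆ G.Anc Y := by
  rintro a ⟨b, hb, hab⟩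
  obtain ⟨c, hc, hbc⟩ := h hb
  exact ⟨c, hc, hab.trans hbc⟩

/-! ### Inducing steps -/

/-- `G.ColliderWalk Z x k y l` says that there is a walk with at least one edge from `x` to `y`,
with mark `k` at its start `x` and mark `l` at its end `y`, whose interior nodes are colliders
in `Z`. -/
inductive ColliderWalk (G : MixedGraph I V) (Z : Set (I ⊕ V)) :
    I ⊕ V → EndMark → I ⊕ V → EndMark → Prop
  | edge {x y : I ⊕ V} {k l : EndMark} : x ≠ y → G.edge x y k l → ColliderWalk G Z x k y l
  | cons {x c y : I ⊕ V} {k l : EndMark} : x ≠ c → G.edge x c k .arrow → c ∈ Z →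
      ColliderWalk G Z c .arrow y l → ColliderWalk G Z x k y l

namespace ColliderWalk

variable {G : MixedGraph I V} {Z Z' : Set (I ⊕ V)} {x y c : I ⊕ V} {k l : EndMark}

lemma mono (hZ : Z ⊆ Z') (h : G.ColliderWalk Z x k y l) : G.ColliderWalk Z' x k y l := by
  induction h with
  | edge hne he => exact .edge hne he
  | cons hne he hc _ ih => exact .cons hne he (hZ hc) ih

lemma trans_of_eq_arrow {l₁ : EndMark} (h : G.ColliderWalk Z x k c l₁) (hl : l₁ = .arrow)
    (hc : c ∈ Z) (h' : G.ColliderWalk Z c .arrow y l) : G.ColliderWalk Z x k y l := by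
  induction h with
  | edge hne he => exact .cons hne (hl ▸ he) hc h'
  | cons hne he hd _ ih => exact .cons hne he hd (ih hl hc h')

lemma trans (h : G.ColliderWalk Z x k c .arrow) (hc : c ∈ Z)
    (h' : G.ColliderWalk Z c .arrow y l) : G.ColliderWalk Z x k y l :=
  h.trans_of_eq_arrow rfl hc h'

lemma symm (h : G.ColliderWalk Z x k y l) : G.ColliderWalk Z y l x k := by
  induction h with
  | edge hne he => exact .edge hne.symm (G.edge_symm he)
  | cons hne he hc _ ih => exact ih.trans hc (.edge hne.symm (G.edge_symm he))

lemma exists_edge (h : G.ColliderWalk Z x k y l) : ∃ z m, G.edge x z k m := by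
  cases h with
  | edge _ he => exact ⟨_, _, he⟩
  | cons _ he _ _ => exact ⟨_, _, he⟩

lemma exists_walk (h : G.ColliderWalk Z x k y l) :
    ∃ π : G.Walk, π.first = x ∧ π.last = y ∧ π.markL 0 = k ∧
      ∀ i, i + 1 < π.length → π.ColliderAt i ∧ π.node (i + 1) ∈ Z := by
  induction h with
  | @edge x y k l hne he =>
    refine ⟨⟨1, fun t => if t = 0 then x else y, fun _ => k, fun _ => l, ?_, ?_⟩, ?_⟩
    · intro i hi
      obtain rfl : i = 0 := by omega
      simpa using hne
    · intro i hi
      obtain rfl : i = 0 := by omega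
      simpa using he
    · simp [Walk.first, Walk.last]
  | @cons x c y k l hne he hc _ ih =>
    obtain ⟨π, hf, hl, hk, ho⟩ := ih
    have hf : π.node 0 = c := hf
    refine ⟨⟨π.length + 1, fun | 0 => x | t + 1 => π.node t,
      fun | 0 => k | t + 1 => π.markL t, fun | 0 => .arrow | t + 1 => π.markR t, ?_, ?_⟩,
      rfl, hl, rfl, ?_⟩
    · rintro (_ | i) hi
      · simpa [hf] using hne
      · exact π.node_ne i (by omega)
    · rintro (_ | i) hi
      · simpa [hf] using he
      · exact π.edge_mem i (by omega)
    · rintro (_ | i) hi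
      · exact ⟨⟨rfl, hk⟩, by simpa [hf] using hc⟩
      · exact ho i (by simpa using hi)

end ColliderWalk

/-- A walk that visits the same node at the positions `i < j` becomes shorter, with the same ends,
when the part in between is left out. If it is inducing, this leaves the node a collider, unless
it becomes an endnode. -/
lemma Walk.exists_shorter {G : MixedGraph I V} {S : Set (I ⊕ V)} (π : G.Walk)
    (hπ : π.IsInducing ∅ S) {i j : ℕ} (hij : i < j) (hj : j ≤ π.length)
    (he : π.node i = π.node j) :
    ∃ ρ : G.Walk, ρ.length < π.length ∧ ρ.first = π.first ∧ ρ.last = π.last ∧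
      ρ.IsInducing ∅ S := by
  obtain ⟨d, rfl⟩ := Nat.exists_eq_add_of_le hij.le
  have hcol : ∀ t, t + 1 < π.length → π.ColliderAt t := fun t ht => by
    simpa using hπ.1 t ht
  have hnode : ∀ t, t ≤ i → (if t < i then π.node t else π.node (t + d)) = π.node t := by
    intro t ht
    split_ifs with h
    · rfl
    · rw [show t = i by omega, he]
  have hfirst : (if 0 < i then π.node 0 else π.node (0 + d)) = π.node 0 := hnode 0 (Nat.zero_le _)
  have hlast : (if π.length - d < i then π.node (π.length - d) else π.node (π.length - d + d))
      = π.node π.length := by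
    rw [if_neg (by omega), show π.length - d + d = π.length by omega]
  have hsucc : ∀ t, ¬ t < i → t + 1 + d = t + d + 1 := fun t _ => by omega
  refine ⟨⟨π.length - d, fun t => if t < i then π.node t else π.node (t + d),
    fun t => if t < i then π.markL t else π.markL (t + d),
    fun t => if t < i then π.markR t else π.markR (t + d), ?_, ?_⟩, ?_, hfirst, hlast, ?_, ?_⟩
  · intro t ht
    by_cases h : t < i
    · simpa only [hnode t h.le, hnode (t + 1) h] using π.node_ne t (by omega)
    · simpa only [h, if_false, show ¬ t + 1 < i by omega, hsucc t h]
        using π.node_ne (t + d) (by omega)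
  · intro t ht
    by_cases h : t < i
    · simpa only [hnode t h.le, hnode (t + 1) h, h, if_true] using π.edge_mem t (by omega)
    · simpa only [h, if_false, show ¬ t + 1 < i by omega, hsucc t h]
        using π.edge_mem (t + d) (by omega)
  · dsimp only
    omega
  · intro t ht
    refine .inr ⟨?_, ?_⟩
    · dsimp only at ht ⊢
      split_ifs with h
      · exact (hcol t (by omega)).1
      · exact (hcol (t + d) (by omega)).1
    · dsimp only at ht ⊢
      split_ifs with h
      · exact (hcol t (by omega)).2
      · rw [show t + 1 + d = t + d + 1 by omega]
        exact (hcol (t + d) (by omega)).2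
  · intro t ht _
    dsimp only [Walk.first, Walk.last] at ht ⊢
    rw [hfirst, hlast]
    by_cases h : t < i
    · rw [hnode (t + 1) h]
      exact hπ.2 t (by omega) (hcol t (by omega))
    · rw [if_neg (by omega), hsucc t h]
      exact hπ.2 (t + d) (by omega) (hcol (t + d) (by omega))

lemma Walk.IsInducing.hasInducingPath {G : MixedGraph I V} {S : Set (I ⊕ V)} {a b : I ⊕ V}
    {π : G.Walk} (hπ : π.IsInducing ∅ S) (ha : π.first = a) (hb : π.last = b) :
    G.HasInducingPath ∅ S a b := by
  induction hn : π.length using Nat.strong_induction_on generalizing π with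
  | _ n ih =>
    by_cases hp : π.IsPath
    · exact ⟨π, hp, ha, hb, hπ⟩
    · have : ∃ i j, i < j ∧ j ≤ π.length ∧ π.node i = π.node j := by
        simp only [Walk.IsPath, not_forall] at hp
        obtain ⟨i, hi, j, hj, he, hne⟩ := hp
        rcases lt_or_gt_of_ne hne with h | h
        · exact ⟨i, j, h, hj, he⟩
        · exact ⟨j, i, h, hi, he.symm⟩
      obtain ⟨i, j, hij, hj, he⟩ := this
      obtain ⟨ρ, hlt, hf, hl, hρ⟩ := π.exists_shorter hπ hij hj he
      exact ih _ (hn ▸ hlt) hρ (hf.trans ha) (hl.trans hb) rfl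

/-- There is a walk from `x` to `y`, with marks `k` and `l` at its ends, that is inducing
given `S`. The ends may coincide. -/
def InducingStep (G : MixedGraph I V) (S : Set (I ⊕ V)) (x : I ⊕ V) (k : EndMark) (y : I ⊕ V)
    (l : EndMark) : Prop :=
  G.ColliderWalk (G.Anc ({x, y} ∪ S)) x k y l

namespace InducingStep

variable {G : MixedGraph I V} {S : Set (I ⊕ V)} {x y c : I ⊕ V} {k l : EndMark}

lemma symm (h : G.InducingStep S x k y l) : G.InducingStep S y l x k := by
  have := ColliderWalk.symm h
  rwa [Set.pair_comm] at this

lemma hasInducingPath (h : G.InducingStep S x k y l) : G.HasInducingPath ∅ S x y := by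
  obtain ⟨π, hf, hl, -, ho⟩ := ColliderWalk.exists_walk h
  exact Walk.IsInducing.hasInducingPath (π := π)
    ⟨fun i hi => .inr (ho i hi).1, fun i hi _ => by rw [hf, hl]; exact (ho i hi).2⟩ hf hl

/-- Two inducing steps that meet head to head at `c` merge if `c` is an ancestor of the selection
nodes or of one of the outer ends. -/
lemma trans (h : G.InducingStep S x k c .arrow) (h' : G.InducingStep S c .arrow y l)
    (hc : c ∈ G.Anc ({x, y} ∪ S)) : G.InducingStep S x k y l := by
  have hsub : ({x, y} ∪ S : Set (I ⊕ V)) ⊆ G.Anc ({x, y} ∪ S) := subset_anc _ _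
  refine ColliderWalk.trans (ColliderWalk.mono (Anc.subset_of_subset ?_) h) hc
    (ColliderWalk.mono (Anc.subset_of_subset ?_) h')
  · rintro z ((rfl | rfl) | hz)
    · exact hsub (by simp)
    · exact hc
    · exact hsub (.inr hz)
  · rintro z ((rfl | rfl) | hz)
    · exact hc
    · exact hsub (by simp)
    · exact hsub (.inr hz)

/-- An inducing step with a tail at its start makes the start a proper ancestor of its end or of a
selection node: the first edge is directed, and by acyclicity it cannot lead back. -/
lemma transGen_left (hG : G.IsIADMG) (h : G.InducingStep S x .tail y l) :
    ∃ z ∈ {y} ∪ S, Relation.TransGen G.Parent x z := by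
  cases h with
  | edge _ he =>
    cases l with
    | tail => exact (hG.not_undirected _ _ he).elim
    | arrow => exact ⟨y, .inl rfl, .single he⟩
  | @cons _ c _ _ _ _ he hc _ =>
    obtain ⟨z, hz, hcz⟩ := hc
    have hxz : Relation.TransGen G.Parent x z := Relation.TransGen.head' he hcz
    rcases hz with (rfl | rfl) | hz
    · exact (hG.acyclic _ hxz).elim
    · exact ⟨z, .inl rfl, hxz⟩
    · exact ⟨z, .inr hz, hxz⟩

lemma mem_anc_left (hG : G.IsIADMG) (h : G.InducingStep S x .tail y l) :
    x ∈ G.Anc ({y} ∪ S) :=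
  let ⟨_, hz, hxz⟩ := h.transGen_left hG
  Anc.of_transGen hz hxz

lemma mem_anc_of_self (hG : G.IsIADMG) (h : G.InducingStep S x .tail x l) : x ∈ G.Anc S := by
  obtain ⟨z, rfl | hz, hxz⟩ := h.transGen_left hG
  · exact (hG.acyclic _ hxz).elim
  · exact Anc.of_transGen hz hxz

end InducingStep

/-- `G.InducingChain S A C n x m` is `G.OpenReach A C x m` with inducing steps given `S` in the place
of edges, and with the number `n` of steps recorded. -/
inductive InducingChain (G : MixedGraph I V) (S A C : Set (I ⊕ V)) :
    ℕ → I ⊕ V → EndMark → Prop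
  | start {a : I ⊕ V} : a ∈ A → InducingChain G S A C 0 a .tail
  | step {n : ℕ} {x y : I ⊕ V} {m k l : EndMark} : InducingChain G S A C n x m →
      G.InducingStep S x k y l → G.Passes C m k x → InducingChain G S A C (n + 1) y l

lemma OpenReach.exists_inducingChain {G : MixedGraph I V} {A C : Set (I ⊕ V)} {x : I ⊕ V}
    {m : EndMark} (S : Set (I ⊕ V)) (h : G.OpenReach A C x m) :
    ∃ n, G.InducingChain S A C n x m := by
  induction h with
  | start ha => exact ⟨0, .start ha⟩
  | step _ hne he hp ih =>
    obtain ⟨n, hn⟩ := ih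
    exact ⟨n + 1, .step hn (.edge hne he) hp⟩

/-! ### From an open walk of a represented isADMG to one of the iMAG -/

open ISADMG

lemma obs_injective (I O S : Type*) : Function.Injective (obs S : I ⊕ O → I ⊕ (O ⊕ S)) :=
  Sum.map_injective.2 ⟨Function.injective_id, Sum.inl_injective⟩

lemma exists_obs_or_mem_selection {I O S : Type*} (u : I ⊕ (O ⊕ S)) :
    (∃ x, u = obs S x) ∨ u ∈ selection I O S := by
  rcases u with i | o | s
  · exact .inl ⟨Sum.inl i, rfl⟩
  · exact .inl ⟨Sum.inr o, rfl⟩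
  · exact .inr ⟨s, rfl⟩

lemma obs_notMem_selection {I O S : Type*} (x : I ⊕ O) : obs S x ∉ selection I O S := by
  rintro ⟨s, hs⟩
  rcases x with i | o <;> simp [obs] at hs

lemma obs_mem_union_selection {I O S : Type*} {C : Set (I ⊕ O)} {x : I ⊕ O} :
    obs S x ∈ obs S '' C ∪ selection I O S ↔ x ∈ C := by
  simp [obs_notMem_selection, (obs_injective I O S).mem_set_image]

namespace Represents

variable {S : Type*} {M : MixedGraph I V} {𝔄 : ISADMG I V S}

lemma mark_eq_tail (hR : M.Represents 𝔄) {a b : I ⊕ V} {m m' : EndMark} (h : M.edge a b m m')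
    (ha : obs S a ∈ 𝔄.Anc ({obs S b} ∪ selection I V S)) : m = .tail := by
  cases m with
  | tail => rfl
  | arrow => exact (hR.arrow a b m' h ha).elim

lemma mark_eq_arrow (hR : M.Represents 𝔄) {a b : I ⊕ V} {m m' : EndMark} (h : M.edge a b m m')
    (ha : obs S a ∉ 𝔄.Anc ({obs S b} ∪ selection I V S)) : m = .arrow := by
  cases m with
  | tail => exact (ha (hR.tail a b m' h)).elim
  | arrow => rfl

/-- A directed path that starts outside the ancestors of the selection nodes consists of observed
nodes, and its edges are directed edges of the iMAG. -/
lemma reflTransGen_of_obs (hR : M.Represents 𝔄) {v : I ⊕ V}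
    (hv : obs S v ∉ 𝔄.Anc (selection I V S)) {u : I ⊕ (V ⊕ S)}
    (h : Relation.ReflTransGen 𝔄.Parent (obs S v) u) :
    ∃ w, u = obs S w ∧ Relation.ReflTransGen M.Parent v w := by
  induction h with
  | refl => exact ⟨v, rfl, .refl⟩
  | @tail u u' huv he ih =>
    obtain ⟨w, rfl, hvw⟩ := ih
    have hvu : Relation.ReflTransGen 𝔄.Parent (obs S v) u' := huv.tail he
    obtain ⟨w', rfl⟩ | hsel := exists_obs_or_mem_selection u'
    · refine ⟨w', rfl, hvw.tail ?_⟩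
      have hne : w ≠ w' := by
        rintro rfl
        exact 𝔄.isIADMG.not_loop _ _ _ he
      have hinp : ¬ ({w, w'} ⊆ inputs I V) := by
        intro hsub
        obtain ⟨i, rfl⟩ := hsub (show w' ∈ ({w, w'} : Set (I ⊕ V)) by simp)
        exact 𝔄.isIADMG.not_into_input _ _ _ he
      obtain ⟨m, m', hM⟩ := (hR.adj_iff w w' hne).2
        ⟨hinp, InducingStep.hasInducingPath
          (.edge (fun h => hne (obs_injective _ _ _ h)) he)⟩
      obtain rfl := hR.mark_eq_tail hM ⟨obs S w', by simp, .single he⟩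
      have : obs S w' ∉ 𝔄.Anc ({obs S w} ∪ selection I V S) := by
        rintro ⟨z, rfl | hz, hwz⟩
        · exact 𝔄.isIADMG.acyclic _ (Relation.TransGen.head' he hwz)
        · exact hv ⟨z, hz, hvu.trans hwz⟩
      obtain rfl := hR.mark_eq_arrow (M.edge_symm hM) this
      exact hM
    · exact (hv ⟨u', hsel, hvu⟩).elim

lemma mem_anc_of_obs_mem_anc (hR : M.Represents 𝔄) {v : I ⊕ V} {C : Set (I ⊕ V)}
    (hv : obs S v ∉ 𝔄.Anc (selection I V S))
    (h : obs S v ∈ 𝔄.Anc (obs S '' C ∪ selection I V S)) : v ∈ M.Anc C := by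
  obtain ⟨z, ⟨c, hc, rfl⟩ | hz, hvz⟩ := h
  · obtain ⟨w, hw, hvw⟩ := hR.reflTransGen_of_obs hv hvz
    exact ⟨c, hc, by rwa [obs_injective _ _ _ hw]⟩
  · exact (hv ⟨z, hz, hvz⟩).elim

/-- A shortest chain of inducing steps to an observed node translates into an open walk of the iMAG.
The arrival mark `m'` in the iMAG is a tail if the arrival mark in the chain is one, or if the node is
an ancestor of the selection nodes. It is an arrowhead if the chain arrives with one and the node is
neither an ancestor of the selection nodes nor of any node `w` that can stand before it in a chain
of the same length. -/
lemma openReach_of_minimal (hR : M.Represents 𝔄) {A B C : Set (I ⊕ V)} (hsep : M.IdSep A B C)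
    {n : ℕ} {y : I ⊕ V} {l : EndMark}
    (h : 𝔄.InducingChain (selection I V S) (obs S '' A) (obs S '' C ∪ selection I V S) n
      (obs S y) l)
    (hmin : ∀ n' < n, ¬ 𝔄.InducingChain (selection I V S) (obs S '' A)
      (obs S '' C ∪ selection I V S) n' (obs S y) l) :
    ∃ m', M.OpenReach A C y m' ∧
      (l = .tail ∨ obs S y ∈ 𝔄.Anc (selection I V S) → m' = .tail) ∧
      (l = .arrow → (∀ n' w m k, n = n' + 1 →
        𝔄.InducingChain (selection I V S) (obs S '' A) (obs S '' C ∪ selection I V S) n' w m →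
        𝔄.Passes (obs S '' C ∪ selection I V S) m k w →
        𝔄.InducingStep (selection I V S) w k (obs S y) .arrow →
        obs S y ∉ 𝔄.Anc ({w} ∪ selection I V S)) → m' = .arrow) := by
  induction n generalizing y l with
  | zero =>
    generalize hu : obs S y = u at h
    cases h with
    | start ha =>
      obtain ⟨a, ha, rfl⟩ := ha
      obtain rfl := obs_injective _ _ _ hu
      exact ⟨.tail, .start ha, by simp, by simp⟩
  | succ n ih =>
    generalize hu : obs S y = u at h
    cases h with
    | @step _ x _ m k _ hx hs hp =>
    subst hu
    have hG := 𝔄.isIADMG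
    have hxmin : ∀ n' < n, ¬ 𝔄.InducingChain (selection I V S) (obs S '' A)
        (obs S '' C ∪ selection I V S) n' x m :=
      fun n' hn' hx' => hmin (n' + 1) (by omega) (.step hx' hs hp)
    -- If the collider `x` were an ancestor of a selection node or of a neighbour, merging the two
    -- steps at it would give a shorter chain with the same arrival mark.
    have hmerge : m = .arrow → k = .arrow → ∀ n' w m₀ k₀, n = n' + 1 →
        𝔄.InducingChain (selection I V S) (obs S '' A) (obs S '' C ∪ selection I V S) n' w m₀ →
        𝔄.Passes (obs S '' C ∪ selection I V S) m₀ k₀ w →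
        𝔄.InducingStep (selection I V S) w k₀ x .arrow →
        x ∉ 𝔄.Anc ({w, obs S y} ∪ selection I V S) := by
      rintro rfl rfl n' w m₀ k₀ hn hw hpw hsw hanc
      exact hmin (n' + 1) (by omega) (.step hw (hsw.trans hs hanc) hpw)
    have hcol : m = .arrow → k = .arrow → x ∉ 𝔄.Anc ({obs S y} ∪ selection I V S) := by
      rintro rfl rfl hanc
      cases hx with
      | step hw hsw hpw =>
        refine hmerge rfl rfl _ _ _ _ rfl hw hpw hsw (Anc.mono ?_ hanc)
        exact Set.union_subset_union_left _ (by simp)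
    have hsub : selection I V S ⊆ {obs S y} ∪ selection I V S := Set.subset_union_right
    obtain ⟨x, rfl⟩ : ∃ x', x = obs S x' := by
      refine (exists_obs_or_mem_selection x).resolve_right fun hxS => ?_
      rcases hp with ⟨_, hp⟩ | ⟨_, hp⟩ | ⟨⟨hm, hk⟩, _⟩
      · exact hp (.inr hxS)
      · exact hp (.inr hxS)
      · exact hcol hm hk (Anc.mono hsub (subset_anc _ _ hxS))
    obtain ⟨m', hreach, htail, harrow⟩ := ih hx hxmin
    by_cases hxy : x = y
    · -- The step is a closed walk, which contributes nothing to the walk in the iMAG.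
      subst hxy
      refine ⟨m', hreach, ?_, ?_⟩
      · rintro (rfl | hanc)
        · exact htail (.inr (hs.symm.mem_anc_of_self hG))
        · exact htail (.inr hanc)
      · rintro rfl hgood
        exact (hgood n _ _ _ rfl hx hp hs (subset_anc _ _ (by simp))).elim
    · have hinp : ¬ ({x, y} ⊆ inputs I V) := by
        intro hsub
        obtain ⟨i, rfl⟩ := hsub (show x ∈ ({x, y} : Set (I ⊕ V)) by simp)
        refine not_idSep_iff.2 ⟨Sum.inl i, .inr ⟨i, rfl⟩, fun hC => ?_, m', hreach⟩ hsep
        have hC' : obs S (Sum.inl i) ∈ obs S '' C ∪ selection I V S := .inl ⟨_, hC, rfl⟩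
        obtain ⟨z, q, hz⟩ := ColliderWalk.exists_edge hs
        rcases hp with ⟨_, hp⟩ | ⟨_, hp⟩ | ⟨⟨_, rfl⟩, _⟩
        · exact hp hC'
        · exact hp hC'
        · exact hG.not_into_input _ _ _ (𝔄.edge_symm hz)
      obtain ⟨p, q, hM⟩ := (hR.adj_iff x y hxy).2 ⟨hinp, hs.hasInducingPath⟩
      refine ⟨q, .step hreach hxy hM ?_, ?_, ?_⟩
      · rcases hp with ⟨hm, hp⟩ | ⟨rfl, hp⟩ | ⟨⟨hm, hk⟩, hp⟩
        · exact .inl ⟨htail (.inl hm), fun h => hp (.inl ⟨x, h, rfl⟩)⟩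
        · exact .inr (.inl ⟨hR.mark_eq_tail hM (hs.mem_anc_left hG),
            fun h => hp (.inl ⟨x, h, rfl⟩)⟩)
        · refine .inr (.inr ⟨⟨harrow hm ?_, hR.mark_eq_arrow hM (hcol hm hk)⟩,
            hR.mem_anc_of_obs_mem_anc (fun h => hcol hm hk (Anc.mono hsub h)) hp⟩)
          intro n' w m₀ k₀ hn hw hpw hsw hanc
          refine hmerge hm hk n' w m₀ k₀ hn hw hpw hsw (Anc.mono ?_ hanc)
          exact Set.union_subset_union_left _ (by simp)
      · intro h
        refine hR.mark_eq_tail (M.edge_symm hM) ?_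
        rcases h with rfl | h
        · exact hs.symm.mem_anc_left hG
        · exact Anc.mono Set.subset_union_right h
      · rintro rfl hgood
        exact hR.mark_eq_arrow (M.edge_symm hM) (hgood n _ _ _ rfl hx hp hs)

theorem idSep (hR : M.Represents 𝔄) {A B C : Set (I ⊕ V)} (hsep : M.IdSep A B C) :
    𝔄.IdSep (obs S '' A) (obs S '' B) (obs S '' C ∪ selection I V S) := by
  classical
  by_contra hnot
  obtain ⟨u, hB, hC, m, h⟩ := not_idSep_iff.1 hnot
  obtain ⟨b, hb, rfl⟩ : ∃ b ∈ B ∪ inputs I V, u = obs S b := by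
    rcases hB with ⟨b, hb, rfl⟩ | ⟨i, rfl⟩
    · exact ⟨b, .inl hb, rfl⟩
    · exact ⟨Sum.inl i, .inr ⟨i, rfl⟩, rfl⟩
  have hch := h.exists_inducingChain (selection I V S)
  obtain ⟨m', hm', -⟩ := hR.openReach_of_minimal hsep (Nat.find_spec hch)
    fun n' hn' => Nat.find_min hch hn'
  exact not_idSep_iff.2 ⟨b, hb, fun h => hC (.inl ⟨b, h, rfl⟩), m', hm'⟩ hsep

end Represents

/-! ### The canonical isADMG of an iMAG -/

/-- The selection nodes of the canonical isADMG: the ordered pairs of nodes that are joined by an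
undirected edge. So every undirected edge gives rise to two selection nodes. -/
abbrev UndirectedPair (M : MixedGraph I V) :=
  {p : (I ⊕ V) × (I ⊕ V) // M.edge p.1 p.2 .tail .tail}

/-- The selection node of the canonical isADMG that belongs to an undirected edge. -/
def sel {M : MixedGraph I V} (s : M.UndirectedPair) : I ⊕ (V ⊕ M.UndirectedPair) :=
  Sum.inr (Sum.inr s)

/-- `x` is one of the two ends of an undirected edge. -/
def UndirectedPair.HasEnd {M : MixedGraph I V} (s : M.UndirectedPair) (x : I ⊕ V) : Prop :=
  x = s.1.1 ∨ x = s.1.2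

/-- The mixed graph in which every undirected edge `a — b` of `M` is replaced by `a → s ← b` with
selection nodes `s`. -/
def canonicalGraph (M : MixedGraph I V) : MixedGraph I (V ⊕ M.UndirectedPair) where
  edge u v m m' :=
    (∃ a b, u = obs _ a ∧ v = obs _ b ∧ M.edge a b m m' ∧ ¬ (m = .tail ∧ m' = .tail)) ∨
    (∃ (a : I ⊕ V) (s : M.UndirectedPair), u = obs _ a ∧ v = sel s ∧ s.HasEnd a ∧
      m = .tail ∧ m' = .arrow) ∨
    (∃ (a : I ⊕ V) (s : M.UndirectedPair), v = obs _ a ∧ u = sel s ∧ s.HasEnd a ∧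
      m' = .tail ∧ m = .arrow)
  edge_symm := by
    rintro u v m m' (⟨a, b, hu, hv, he, hn⟩ | h | h)
    · exact .inl ⟨b, a, hv, hu, M.edge_symm he, fun h => hn h.symm⟩
    · exact .inr (.inr h)
    · exact .inr (.inl h)

section Canonical

variable {M : MixedGraph I V}

lemma obs_ne_sel (x : I ⊕ V) (s : M.UndirectedPair) : obs _ x ≠ sel s :=
  fun h => obs_notMem_selection x ⟨s, h.symm⟩

lemma sel_injective : Function.Injective (sel : M.UndirectedPair → I ⊕ (V ⊕ M.UndirectedPair)) :=
  Sum.inr_injective.comp Sum.inr_injective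

lemma canonicalGraph_edge_obs {a b : I ⊕ V} {m m' : EndMark} :
    M.canonicalGraph.edge (obs _ a) (obs _ b) m m' ↔
      M.edge a b m m' ∧ ¬ (m = .tail ∧ m' = .tail) := by
  constructor
  · rintro (⟨a', b', ha, hb, he⟩ | ⟨_, s, _, hs, _⟩ | ⟨_, s, _, hs, _⟩)
    · rwa [obs_injective _ _ _ ha, obs_injective _ _ _ hb]
    · exact (obs_ne_sel _ _ hs).elim
    · exact (obs_ne_sel _ _ hs).elim
  · exact fun h => .inl ⟨a, b, rfl, rfl, h⟩

lemma exists_of_canonicalGraph_edge_sel {u : I ⊕ (V ⊕ M.UndirectedPair)} {s : M.UndirectedPair}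
    {m m' : EndMark} (h : M.canonicalGraph.edge u (sel s) m m') :
    ∃ a, u = obs _ a ∧ s.HasEnd a ∧ m = .tail ∧ m' = .arrow := by
  rcases h with ⟨_, b, _, hb, _⟩ | ⟨a, s', hu, hs, he, hm⟩ | ⟨a, s', ha, _⟩
  · exact (obs_ne_sel _ _ hb.symm).elim
  · obtain rfl := sel_injective hs
    exact ⟨a, hu, he, hm⟩
  · exact (obs_ne_sel _ _ ha.symm).elim

lemma canonicalGraph_edge_obs_sel {a : I ⊕ V} {s : M.UndirectedPair} (h : s.HasEnd a) :
    M.canonicalGraph.edge (obs _ a) (sel s) .tail .arrow :=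
  .inr (.inl ⟨a, s, rfl, rfl, h, rfl, rfl⟩)

lemma exists_of_canonicalGraph_edge_arrow {u : I ⊕ (V ⊕ M.UndirectedPair)} {b : I ⊕ V}
    {m : EndMark} (h : M.canonicalGraph.edge u (obs _ b) m .arrow) :
    ∃ a, u = obs _ a ∧ M.edge a b m .arrow := by
  rcases h with ⟨a, b', hu, hb, he, _⟩ | ⟨_, s, _, hs, _⟩ | ⟨_, _, _, _, _, hm, _⟩
  · obtain rfl := obs_injective _ _ _ hb
    exact ⟨a, hu, he⟩
  · exact (obs_ne_sel _ _ hs).elim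
  · simp at hm

lemma IsIMAG.not_edge_arrow_of_hasEnd (hM : M.IsIMAG) {s : M.UndirectedPair} {x y : I ⊕ V}
    {m : EndMark} (hs : s.HasEnd x) : ¬ M.edge y x m .arrow := by
  intro h
  rcases hs with rfl | rfl
  · exact hM.not_into_undirected _ _ _ _ h s.2
  · exact hM.not_into_undirected _ _ _ _ h (M.edge_symm s.2)

lemma canonicalGraph_parent_obs {a b : I ⊕ V} :
    M.canonicalGraph.Parent (obs _ a) (obs _ b) ↔ M.Parent a b := by
  simp [Parent, canonicalGraph_edge_obs]

/-- Directed walks of the canonical isADMG are those of the iMAG, possibly continued by a last edge to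
a selection node. -/
lemma reflTransGen_canonicalGraph {x : I ⊕ V} {u : I ⊕ (V ⊕ M.UndirectedPair)}
    (h : Relation.ReflTransGen M.canonicalGraph.Parent (obs _ x) u) :
    ∃ y, Relation.ReflTransGen M.Parent x y ∧
      (u = obs _ y ∨ ∃ s : M.UndirectedPair, u = sel s ∧ s.HasEnd y) := by
  induction h with
  | refl => exact ⟨x, .refl, .inl rfl⟩
  | @tail u v _ he ih =>
    obtain ⟨y, hxy, rfl | ⟨s, rfl, _⟩⟩ := ih
    · obtain ⟨z, rfl⟩ | ⟨s, rfl⟩ := exists_obs_or_mem_selection v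
      · exact ⟨z, hxy.tail (canonicalGraph_parent_obs.1 he), .inl rfl⟩
      · obtain ⟨y', hy', hs, _⟩ := exists_of_canonicalGraph_edge_sel (s := s) he
        obtain rfl := obs_injective _ _ _ hy'
        exact ⟨y, hxy, .inr ⟨s, rfl, hs⟩⟩
    · obtain ⟨_, _, _, _, h⟩ := exists_of_canonicalGraph_edge_sel (M.canonicalGraph.edge_symm he)
      simp at h

lemma reflTransGen_canonicalGraph_obs {x y : I ⊕ V} (h : Relation.ReflTransGen M.Parent x y) :
    Relation.ReflTransGen M.canonicalGraph.Parent (obs _ x) (obs _ y) := by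
  induction h with
  | refl => exact .refl
  | tail _ he ih => exact ih.tail (canonicalGraph_parent_obs.2 he)

/-- A node with an arrowhead at it is an ancestor in the canonical isADMG only of what it is an
ancestor of in the iMAG: no undirected edge starts at it or at a descendant of it. -/
lemma IsIMAG.mem_anc_of_obs_mem_anc (hM : M.IsIMAG) {x y : I ⊕ V} {m : EndMark}
    (hx : M.edge y x m .arrow) {X : Set (I ⊕ V)}
    (h : obs _ x ∈ M.canonicalGraph.Anc (obs _ '' X ∪ selection I V _)) : x ∈ M.Anc X := by
  obtain ⟨u, hu, hxu⟩ := h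
  obtain ⟨z, hxz, rfl | ⟨s, rfl, hs⟩⟩ := reflTransGen_canonicalGraph hxu
  · exact ⟨z, obs_mem_union_selection.1 hu, hxz⟩
  · rcases Relation.ReflTransGen.cases_tail hxz with rfl | ⟨w, _, hw⟩
    · exact (hM.not_edge_arrow_of_hasEnd hs hx).elim
    · exact (hM.not_edge_arrow_of_hasEnd hs hw).elim

lemma IsIMAG.isIADMG_canonicalGraph (hM : M.IsIMAG) : M.canonicalGraph.IsIADMG where
  not_undirected := by
    rintro a b (⟨_, _, _, _, _, h⟩ | ⟨_, _, _, _, _, _, h⟩ | ⟨_, _, _, _, _, _, h⟩) <;> simp at h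
  not_loop := by
    intro u m m' h
    obtain ⟨x, rfl⟩ | ⟨s, rfl⟩ := exists_obs_or_mem_selection u
    · exact hM.not_loop _ _ _ (canonicalGraph_edge_obs.1 h).1
    · obtain ⟨x, hx, _⟩ := exists_of_canonicalGraph_edge_sel (s := s) h
      exact obs_ne_sel _ _ hx.symm
  not_into_input := by
    intro u i m h
    obtain ⟨a, _, ha⟩ := exists_of_canonicalGraph_edge_arrow (b := Sum.inl i) h
    exact hM.not_into_input _ _ _ ha
  acyclic := by
    intro u h
    obtain ⟨v, huv, hvu⟩ := Relation.TransGen.head'_iff.1 h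
    obtain ⟨x, rfl⟩ | ⟨s, rfl⟩ := exists_obs_or_mem_selection u
    · obtain ⟨y, rfl⟩ | ⟨s, rfl⟩ := exists_obs_or_mem_selection v
      · obtain ⟨z, hyz, hz | ⟨s, hs, _⟩⟩ := reflTransGen_canonicalGraph hvu
        · obtain rfl := obs_injective _ _ _ hz
          exact hM.acyclic _ (Relation.TransGen.head' (canonicalGraph_parent_obs.1 huv) hyz)
        · exact obs_ne_sel _ _ hs
      · rcases Relation.ReflTransGen.cases_head hvu with h | ⟨w, hw, _⟩
        · exact obs_ne_sel _ s h.symm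
        · obtain ⟨_, _, _, _, h⟩ :=
            exists_of_canonicalGraph_edge_sel (s := s) (M.canonicalGraph.edge_symm hw)
          simp at h
    · obtain ⟨_, _, _, _, h⟩ :=
        exists_of_canonicalGraph_edge_sel (s := s) (M.canonicalGraph.edge_symm huv)
      simp at h

/-- The canonical isADMG of an iMAG. -/
def canonical (M : MixedGraph I V) (hM : M.IsIMAG) : ISADMG I V M.UndirectedPair where
  toMixedGraph := M.canonicalGraph
  isIADMG := hM.isIADMG_canonicalGraph

lemma IsIMAG.hasInducingPath_canonicalGraph (hM : M.IsIMAG) {a b : I ⊕ V} (h : M.Adj a b) :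
    M.canonicalGraph.HasInducingPath ∅ (selection I V _) (obs _ a) (obs _ b) := by
  obtain ⟨m, m', he⟩ := h
  have hne : obs M.UndirectedPair a ≠ obs _ b := by
    intro h
    obtain rfl := obs_injective _ _ _ h
    exact hM.not_loop _ _ _ he
  by_cases hu : m = .tail ∧ m' = .tail
  · obtain ⟨rfl, rfl⟩ := hu
    let s : M.UndirectedPair := ⟨(a, b), he⟩
    refine InducingStep.hasInducingPath (k := .tail) (l := .tail)
      (.cons (c := sel s) (obs_ne_sel _ _) (canonicalGraph_edge_obs_sel (.inl rfl))
        (subset_anc _ _ (.inr ⟨s, rfl⟩))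
        (.edge (obs_ne_sel _ _).symm (M.canonicalGraph.edge_symm
          (canonicalGraph_edge_obs_sel (.inr rfl)))))
  · exact InducingStep.hasInducingPath (.edge hne (canonicalGraph_edge_obs.2 ⟨he, hu⟩))

lemma IsIMAG.adj_of_hasInducingPath_canonicalGraph (hM : M.IsIMAG) {a b : I ⊕ V} (hab : a ≠ b)
    (h : M.canonicalGraph.HasInducingPath ∅ (selection I V _) (obs _ a) (obs _ b)) :
    M.Adj a b := by
  obtain ⟨π, hpath, hf, hl, hcol, hanc⟩ := h
  have hcol : ∀ t, t + 1 < π.length → π.ColliderAt t := fun t ht => by simpa using hcol t ht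
  by_cases hsel : ∃ t s, t + 1 < π.length ∧ π.node (t + 1) = sel s
  · -- The neighbours of a selection node have no arrowheads, so they are the ends of the path.
    obtain ⟨t, s, ht, hs⟩ := hsel
    obtain ⟨x, hx, hsx, _⟩ := exists_of_canonicalGraph_edge_sel (hs ▸ π.edge_mem t (by omega))
    obtain ⟨y, hy, hsy, _⟩ := exists_of_canonicalGraph_edge_sel
      (M.canonicalGraph.edge_symm (hs ▸ π.edge_mem (t + 1) ht))
    have hxa : x = a := by
      rcases t with _ | t
      · exact obs_injective _ _ _ (hx.symm.trans hf)
      · have he := π.edge_mem t (by omega)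
        rw [hx, (hcol t (by omega)).1] at he
        obtain ⟨_, _, h⟩ := exists_of_canonicalGraph_edge_arrow he
        exact (hM.not_edge_arrow_of_hasEnd hsx h).elim
    have hyb : y = b := by
      rcases Nat.lt_or_ge (t + 2) π.length with hlt | hge
      · have he := M.canonicalGraph.edge_symm (π.edge_mem (t + 2) hlt)
        rw [hy, (hcol (t + 1) hlt).2] at he
        obtain ⟨_, _, h⟩ := exists_of_canonicalGraph_edge_arrow he
        exact (hM.not_edge_arrow_of_hasEnd hsy h).elim
      · have : π.length = t + 1 + 1 := by omega
        rw [Walk.last, this] at hl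
        exact obs_injective _ _ _ (hy.symm.trans hl)
    subst hxa hyb
    rcases hsx with rfl | rfl <;> rcases hsy with rfl | rfl
    · exact (hab rfl).elim
    · exact ⟨_, _, s.2⟩
    · exact ⟨_, _, M.edge_symm s.2⟩
    · exact (hab rfl).elim
  · -- A path through observed nodes is an inducing path of the iMAG.
    push Not at hsel
    by_contra hadj
    have hobs : ∀ t, ∃ x, t ≤ π.length → π.node t = obs _ x := by
      intro t
      by_cases ht : t ≤ π.length
      · rcases t with _ | t
        · exact ⟨a, fun _ => hf⟩
        · rcases Nat.lt_or_ge (t + 1) π.length with h | h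
          · obtain ⟨x, hx⟩ | ⟨s, hs⟩ := exists_obs_or_mem_selection (π.node (t + 1))
            · exact ⟨x, fun _ => hx⟩
            · exact (hsel t s h hs.symm).elim
          · refine ⟨b, fun _ => ?_⟩
            rw [← hl, Walk.last, le_antisymm ht h]
      · exact ⟨a, fun h => (ht h).elim⟩
    choose g hg using hobs
    have hedge : ∀ t < π.length, M.edge (g t) (g (t + 1)) (π.markL t) (π.markR t) := by
      intro t ht
      have := π.edge_mem t ht
      rw [hg t ht.le, hg (t + 1) ht] at this
      exact (canonicalGraph_edge_obs.1 this).1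
    have hga : g 0 = a := obs_injective _ _ _ ((hg 0 (Nat.zero_le _)).symm.trans hf)
    have hgb : g π.length = b := obs_injective _ _ _ ((hg _ le_rfl).symm.trans hl)
    refine hM.maximal a b hab hadj ⟨⟨π.length, g, π.markL, π.markR, ?_, hedge⟩, ?_, hga, hgb,
      fun t ht => .inr (hcol t ht), fun t ht _ => ?_⟩
    · intro t ht h
      have := hedge t ht
      rw [h] at this
      exact hM.not_loop _ _ _ this
    · intro i hi j hj h
      exact hpath i hi j hj (by rw [hg i hi, hg j hj]; exact congrArg _ h)
    · have hlt : t < π.length := Nat.lt_of_succ_lt ht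
      have he := hedge t hlt
      rw [(hcol t ht).1] at he
      have ha := hanc t ht (hcol t ht)
      rw [hf, hl, hg (t + 1) hlt, ← Set.image_pair] at ha
      have := hM.mem_anc_of_obs_mem_anc he ha
      simp only [Walk.first, Walk.last, hga, hgb, Set.union_empty]
      exact this

theorem represents_canonical (hM : M.IsIMAG) : M.Represents (M.canonical hM) where
  adj_iff a b hab := by
    refine ⟨fun h => ⟨fun hsub => ?_, hM.hasInducingPath_canonicalGraph h⟩,
      fun h => hM.adj_of_hasInducingPath_canonicalGraph hab h.2⟩
    obtain ⟨i, rfl⟩ := hsub (show a ∈ ({a, b} : Set (I ⊕ V)) by simp)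
    obtain ⟨j, rfl⟩ := hsub (show b ∈ ({Sum.inl i, b} : Set (I ⊕ V)) by simp)
    exact hM.not_adj_inputs i j h
  arrow a b m h hanc := by
    rw [← Set.image_singleton] at hanc
    obtain ⟨_, rfl, hab⟩ := hM.mem_anc_of_obs_mem_anc (M.edge_symm h) hanc
    rcases Relation.reflTransGen_iff_eq_or_transGen.1 hab with rfl | hab
    · exact hM.not_loop _ _ _ h
    · cases m with
      | tail => exact hM.acyclic _ (hab.tail (M.edge_symm h))
      | arrow => exact hM.not_almost_cycle _ _ hab (M.edge_symm h)
  tail a b m h := by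
    cases m with
    | tail =>
      let s : M.UndirectedPair := ⟨(a, b), h⟩
      exact ⟨sel s, .inr ⟨s, rfl⟩, .single (canonicalGraph_edge_obs_sel (.inl rfl))⟩
    | arrow => exact ⟨obs _ b, .inl rfl, .single (canonicalGraph_parent_obs.2 h)⟩

lemma OpenReach.canonical {A C : Set (I ⊕ V)} {x : I ⊕ V} {m : EndMark}
    (h : M.OpenReach A C x m) :
    M.canonicalGraph.OpenReach (obs _ '' A) (obs _ '' C ∪ selection I V _) (obs _ x) m := by
  induction h with
  | start ha => exact .start ⟨_, ha, rfl⟩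
  | @step x y m k l _ hne he hp ih =>
    have hp' : M.canonicalGraph.Passes (obs _ '' C ∪ selection I V _) m k (obs _ x) := by
      rcases hp with ⟨hm, hx⟩ | ⟨hk, hx⟩ | ⟨hmk, c, hc, hxc⟩
      · exact .inl ⟨hm, obs_mem_union_selection.not.2 hx⟩
      · exact .inr (.inl ⟨hk, obs_mem_union_selection.not.2 hx⟩)
      · exact .inr (.inr ⟨hmk, obs _ c, .inl ⟨c, hc, rfl⟩, reflTransGen_canonicalGraph_obs hxc⟩)
    by_cases hu : k = .tail ∧ l = .tail
    · obtain ⟨rfl, rfl⟩ := hu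
      let s : M.UndirectedPair := ⟨(x, y), he⟩
      refine .step (.step ih (obs_ne_sel _ s) (canonicalGraph_edge_obs_sel (.inl rfl)) hp')
        (obs_ne_sel _ s).symm (M.canonicalGraph.edge_symm (canonicalGraph_edge_obs_sel (.inr rfl)))
        (.inr (.inr ⟨⟨rfl, rfl⟩, subset_anc _ _ (.inr ⟨s, rfl⟩)⟩))
    · exact .step ih (fun h => hne (obs_injective _ _ _ h))
        (canonicalGraph_edge_obs.2 ⟨he, hu⟩) hp'

end Canonical

end MixedGraph

theorem mainTheorem9 {I V : Type u} [Finite I] [Finite V]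
    (M : MixedGraph I V) (hM : M.IsIMAG) (A B C : Set (I ⊕ V)) :
    M.IdSep A B C ↔
      ∀ (S : Type u) [Finite S] (𝔄 : ISADMG I V S), M.Represents 𝔄 →
        𝔄.IdSep (ISADMG.obs S '' A) (ISADMG.obs S '' B)
          (ISADMG.obs S '' C ∪ ISADMG.selection I V S) := by
  refine ⟨fun hsep S _ 𝔄 hR => hR.idSep hsep, fun h => ?_⟩
  by_contra hnot
  obtain ⟨b, hB, hC, m, hb⟩ := MixedGraph.not_idSep_iff.1 hnot
  refine MixedGraph.not_idSep_iff.2 ⟨ISADMG.obs _ b, ?_,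
    MixedGraph.obs_mem_union_selection.not.2 hC, m, hb.canonical⟩
    (h M.UndirectedPair (M.canonical hM) (MixedGraph.represents_canonical hM))
  rcases hB with hB | ⟨i, rfl⟩
  · exact .inl ⟨b, hB, rfl⟩
  · exact .inr ⟨i, rfl⟩
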